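/- Let $K$ be a number field with ring of integers $\mathcal{O}_K$, let $k\ge 1$, and let $n_1,\dots,n_k\ge 2$ be integers. Let $$A=\mathcal{O}_K[T_{u,v} : 1\le u\le k,\ 1\le v\le n_u]$$ be the polynomial ring in independent indeterminates $T_{u,v}$, and let $\mathbf{L}$ be its fraction field. For $1\le u\le k$ let $$g_u(x)=x^{n_u}+\sum_{v=1}^{n_u}T_{u,v}\,x^{n_u-v}\in A[x]$$ be the generic monic polynomial of degree $n_u$, and let $F(x)=g_k(g_{k-1}(\cdots g_1(x)\cdots))\in A[x]$. Then: 1. $F$ is irreducible over $\mathbf{L}$, of degree $N=n_1n_2\cdots n_k$; 2. the Galois group over $\mathbf{L}$ of the splitting field of $F$ over $\mathbf{L}$ is isomorphic to the iterated wreath product $S_{n_1}\wr S_{n_2}\wr\cdots\wr S_{n_k}$. Here, for permutation groups $G$ on $[m]$ and $H$ on $[n]$, the wreath product $G\wr H$ is the semidirect product $G^n\rtimes H$, where $H$ permutes the $n$ copies of $G$. It is regarded as a permutation group on $[m]\times[n]$ through $(\sigma_1,\dots,\sigma_n;h)\cdot(i,j)=(\sigma_j(i),h(j))$; this operation is associative.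 -/

import Mathlib

namespace OdoniWreath

/-- The wreath product `G ≀ H` of permutation groups `G` on `α` and `H` on `β`, that is the
semidirect product `G ^ β ⋊ H`, realized as a group of permutations of `α × β`: the element with
components `σ : β → G` and `h ∈ H` acts by `(i, j) ↦ (σ j i, h j)`. -/
def wreath {α β : Type*} (G : Subgroup (Equiv.Perm α)) (H : Subgroup (Equiv.Perm β)) :
    Subgroup (Equiv.Perm (α × β)) where
  carrier := {w | ∃ σ : β → Equiv.Perm α, (∀ j, σ j ∈ G) ∧
    ∃ h ∈ H, ∀ i j, w (i, j) = (σ j i, h j)}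
  one_mem' := ⟨fun _ => 1, fun _ => G.one_mem, 1, H.one_mem, fun _ _ => rfl⟩
  mul_mem' := by
    rintro w w' ⟨σ, hσ, h, hh, hw⟩ ⟨σ', hσ', h', hh', hw'⟩
    refine ⟨fun j => σ (h' j) * σ' j, fun j => G.mul_mem (hσ _) (hσ' _), h * h',
      H.mul_mem hh hh', fun i j => ?_⟩
    simp [Equiv.Perm.mul_apply, hw, hw']
  inv_mem' := by
    rintro w ⟨σ, hσ, h, hh, hw⟩
    refine ⟨fun j => (σ (h⁻¹ j))⁻¹, fun j => G.inv_mem (hσ _), h⁻¹, H.inv_mem hh,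
      fun i j => ?_⟩
    rw [Equiv.Perm.inv_eq_iff_eq, hw]
    simp

/-- The set `[n₁] × ([n₂] × (⋯ × [n_k]))` on which `S_{n₁} ≀ S_{n₂} ≀ ⋯ ≀ S_{n_k}` acts
(a single point for `k = 0`). -/
def Index : (k : ℕ) → (Fin k → ℕ) → Type
  | 0, _ => Unit
  | 1, n => Fin (n 0)
  | k + 2, n => Fin (n 0) × Index (k + 1) (Fin.tail n)

/-- The iterated wreath product `S_{n₁} ≀ (S_{n₂} ≀ (⋯ ≀ S_{n_k}))` of symmetric groups
(the trivial group for `k = 0`). -/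
def symWreath : (k : ℕ) → (n : Fin k → ℕ) → Subgroup (Equiv.Perm (Index k n))
  | 0, _ => ⊤
  | 1, _ => ⊤
  | k + 2, n => wreath (⊤ : Subgroup (Equiv.Perm (Fin (n 0)))) (symWreath (k + 1) (Fin.tail n))

/-- The iterated composite `g_k(g_{k-1}(⋯ g₁(x)))` of the polynomials `g₁, …, g_k`: the first
polynomial of the family is the innermost one. -/
noncomputable def iterComp {R : Type*} [CommRing R] :
    (k : ℕ) → (Fin k → Polynomial R) → Polynomial R
  | 0, _ => Polynomial.X
  | k + 1, g => (iterComp k (Fin.tail g)).comp (g 0)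

/-- The ring `A = R[T_{u,v} : 1 ≤ u ≤ k, 1 ≤ v ≤ n_u]`; here `u` and `v` are counted from `0`. -/
abbrev CoeffRing (R : Type*) [CommRing R] {k : ℕ} (n : Fin k → ℕ) : Type _ :=
  MvPolynomial (Σ u : Fin k, Fin (n u)) R

/-- The generic monic polynomial `x ^ n_u + T_{u,1} x ^ (n_u - 1) + ⋯ + T_{u,n_u}`. -/
noncomputable def genericPoly (R : Type*) [CommRing R] {k : ℕ} (n : Fin k → ℕ) (u : Fin k) :
    Polynomial (CoeffRing R n) :=
  Polynomial.X ^ n u + ∑ v : Fin (n u),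
    Polynomial.C (MvPolynomial.X ⟨u, v⟩ : CoeffRing R n) * Polynomial.X ^ (n u - ((v : ℕ) + 1))

/-- The composite `F = g_k(g_{k-1}(⋯ g₁(x)))` of the generic monic polynomials `g_u` of
degrees `n_u`. -/
noncomputable def genericComposite (R : Type*) [CommRing R] {k : ℕ} (n : Fin k → ℕ) :
    Polynomial (CoeffRing R n) :=
  iterComp k (genericPoly R n)

end OdoniWreath

/-!
# The Galois group of a composite of generic polynomials

Write `F = G(g(x))`, where `g` is the generic polynomial of degree `n`, with coefficients `t`, and
`G` is the composite of the other polynomials, with coefficients in a field `L'` over which the `t`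
are algebraically independent. By induction `G` has roots `β j` on which the Galois group acts as
the wreath product `H` of the outer levels. The roots of `F` are the roots `z j i` of the
polynomials `g - β j`, so every automorphism acts on the pairs `(i, j)` through `S_n ≀ H`, and the
content of the theorem is that the whole of `S_n ≀ H` occurs.

Let `C` be the algebraic closure of `L'` in an algebraic closure `Ω` of `L = L'(t)`. As `t` is a
transcendence basis of `Ω` over `C`, every automorphism of `C` over `L'` extends to `Ω` with `t`
fixed (`exists_ringEquiv_of_isTranscendenceBasis`); this realizes all of `H`. It remains to permute
the roots of a single `g - β j` arbitrarily, over `C`, without moving the roots of the others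
(`exists_algEquiv_perm_roots`). This is an inertia argument that needs no discriminants. The roots
`z = z j` form a transcendence basis as well, and `g - β j = ∏ (x - z i)`. Take a maximal ideal `P`
above the origin `z = 0` in the integral closure `S` of `C[z]` in `Ω`. The group `S_n` permutes the
`z i` and fixes the origin. Extend a permutation to an automorphism of `Ω`; since `Gal(Ω / C(z))`
acts transitively on the primes above the origin, the extension can be chosen to preserve `P`, and
as `S / P = C` it then acts trivially modulo `P` (`exists_algEquiv_congr_mod_maximal`). Modulo `P`
the polynomial `g - β j'` becomes `x ^ n - (β j' - β j)`, which is separable for `j' ≠ j`, so its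
roots in `S` are distinct modulo `P` and each of them is fixed (`eq_of_root_of_sub_mem`).

Irreducibility follows because the iterated wreath product is transitive.
-/

namespace OdoniWreath

open Polynomial

universe u v

/-! ### Automorphisms of algebraically closed fields -/

/-- An automorphism of `C` together with a change of transcendence basis extends to an automorphism
of an algebraically closed extension of `C`. -/
theorem exists_ringEquiv_of_isTranscendenceBasis {ι C Ω : Type*} [Field C] [Field Ω]
    [IsAlgClosed Ω] [Algebra C Ω] (θ : C ≃+* C) {t u : ι → Ω} (ht : IsTranscendenceBasis C t)
    (hu : IsTranscendenceBasis C u) :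
    ∃ Φ : Ω ≃+* Ω, (∀ c, Φ (algebraMap C Ω c) = algebraMap C Ω (θ c)) ∧ ∀ i, Φ (t i) = u i := by
  have := IsAlgClosed.isAlgClosure_of_transcendence_basis t ht
  have := IsAlgClosed.isAlgClosure_of_transcendence_basis u hu
  let e : Algebra.adjoin C (Set.range t) ≃+* Algebra.adjoin C (Set.range u) :=
    (ht.1.aevalEquiv.symm.toRingEquiv.trans (MvPolynomial.mapEquiv ι θ)).trans
      hu.1.aevalEquiv.toRingEquiv
  refine ⟨IsAlgClosure.equivOfEquiv Ω Ω e, fun c ↦ ?_, fun i ↦ ?_⟩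
  · rw [IsScalarTower.algebraMap_apply C (Algebra.adjoin C (Set.range t)) Ω,
      IsAlgClosure.equivOfEquiv_algebraMap]
    simp [e]
  · have hti : t i = algebraMap (Algebra.adjoin C (Set.range t)) Ω
        (ht.1.aevalEquiv (MvPolynomial.X i)) := by
      simp
    rw [hti, IsAlgClosure.equivOfEquiv_algebraMap]
    simp [e]

open scoped Pointwise in
/-- The Galois group of a possibly infinite Galois extension `Ω / K` acts transitively on the primes
of the integral closure `S` of `A` in `Ω` above a given prime of the integrally closed ring `A` with
fraction field `K`. The action of `g` on `S` is written `galRestrict A K Ω S g`. -/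
theorem exists_algEquiv_of_under_eq {A K Ω S : Type*} [CommRing A] [IsIntegrallyClosed A]
    [Field K] [Field Ω] [Algebra A K] [IsFractionRing A K] [Algebra K Ω] [Algebra A Ω]
    [IsScalarTower A K Ω] [IsGalois K Ω] [CommRing S] [IsDomain S] [Algebra A S]
    [Algebra S Ω] [IsFractionRing S Ω] [IsScalarTower A S Ω] [IsIntegralClosure S A Ω]
    (P Q : Ideal S) [P.IsPrime] [Q.IsPrime] (h : P.under A = Q.under A) :
    ∃ g : Gal(Ω/K), ∀ x : S, x ∈ Q ↔ galRestrict A K Ω S g x ∈ P := by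
  let := IsIntegralClosure.MulSemiringAction A K Ω S
  have smul_def (g : Gal(Ω/K)) (x : S) : g • x = galRestrict A K Ω S g x := rfl
  have : SMulCommClass Gal(Ω/K) A S := ⟨fun g a x ↦ by simp [smul_def]⟩
  let : TopologicalSpace S := ⊥
  have : DiscreteTopology S := ⟨rfl⟩
  have : Algebra.IsInvariant A S Gal(Ω/K) := by
    refine ⟨fun b hb ↦ ?_⟩
    have hb' : algebraMap S Ω b ∈ (⊥ : IntermediateField K Ω) := by
      rw [InfiniteGalois.mem_bot_iff_fixed]
      intro g
      rw [← algebraMap_galRestrict_apply A g b, ← smul_def, hb]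
    obtain ⟨k, hk⟩ := IntermediateField.mem_bot.1 hb'
    have hi : IsIntegral A k := by
      rw [← isIntegral_algebraMap_iff (FaithfulSMul.algebraMap_injective K Ω), hk]
      exact (IsIntegralClosure.isIntegral A Ω b).algebraMap
    obtain ⟨a, rfl⟩ := IsIntegrallyClosed.algebraMap_eq_of_integral hi
    refine ⟨a, FaithfulSMul.algebraMap_injective S Ω ?_⟩
    rw [← hk, ← IsScalarTower.algebraMap_apply, ← IsScalarTower.algebraMap_apply]
  have : ContinuousSMul Gal(Ω/K) S := by
    refine continuousSMul_iff_stabilizer_isOpen.2 fun x ↦ ?_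
    convert stabilizer_isOpen_of_isIntegral (K := K) (algebraMap S Ω x) using 1
    ext g
    simp only [SetLike.mem_coe, MulAction.mem_stabilizer_iff, smul_def, AlgEquiv.smul_def,
      ← algebraMap_galRestrict_apply A g x]
    exact (FaithfulSMul.algebraMap_injective S Ω).eq_iff.symm
  obtain ⟨g, hg⟩ := Algebra.IsInvariant.exists_smul_of_under_eq_of_profinite (A := A)
    (G := Gal(Ω/K)) P Q h
  refine ⟨g⁻¹, fun x ↦ ?_⟩
  rw [hg, Ideal.mem_pointwise_smul_iff_inv_smul_mem, smul_def]

/-! ### Inertia above the origin -/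

theorem algebra_isIntegral_quotient_of_under_eq_ker {C A S : Type*} [Field C] [CommRing A]
    [CommRing S] [Algebra C A] [Algebra C S] [Algebra A S] [IsScalarTower C A S]
    [Algebra.IsIntegral A S] (ε : A →ₐ[C] C) (P : Ideal S)
    (hPA : P.comap (algebraMap A S) = RingHom.ker ε) : Algebra.IsIntegral C (S ⧸ P) := by
  refine ⟨fun x ↦ ?_⟩
  obtain ⟨x, rfl⟩ := Ideal.Quotient.mk_surjective x
  obtain ⟨p, hp, hpx⟩ := Algebra.IsIntegral.isIntegral (R := A) x
  refine ⟨p.map (ε : A →+* C), hp.map _, ?_⟩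
  have hcomp : (algebraMap C (S ⧸ P)).comp (ε : A →+* C) =
      (Ideal.Quotient.mk P).comp (algebraMap A S) := by
    ext a
    refine (Ideal.Quotient.eq.2 ?_).symm
    change algebraMap A S a - algebraMap C S (ε a) ∈ P
    rw [IsScalarTower.algebraMap_apply C A S, ← map_sub, ← Ideal.mem_comap, hPA, RingHom.mem_ker,
      map_sub, AlgHom.commutes, Algebra.algebraMap_self_apply, sub_self]
  rw [eval₂_map, hcomp, ← hom_eval₂, hpx, map_zero]

/-- An automorphism `Φ` of `Ω` that induces on `A` a map `φ` compatible with a point `ε : A → C` can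
be replaced by an automorphism `ρ` that still induces `φ` and acts trivially modulo a maximal ideal
`P` of `S` above that point. -/
theorem exists_algEquiv_congr_mod_maximal {C A S Ω : Type*} (K : Type*) [Field C] [IsAlgClosed C]
    [CommRing A] [IsIntegrallyClosed A] [Field K] [Field Ω] [Algebra A K] [IsFractionRing A K]
    [Algebra K Ω] [Algebra A Ω] [IsScalarTower A K Ω] [IsGalois K Ω] [CommRing S] [IsDomain S]
    [Algebra A S] [Algebra S Ω] [IsFractionRing S Ω] [IsScalarTower A S Ω] [IsIntegralClosure S A Ω]
    [Algebra C A] [Algebra C S] [Algebra C Ω] [IsScalarTower C A S] [IsScalarTower C A Ω]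
    [IsScalarTower C S Ω]
    (ε : A →ₐ[C] C) (φ : A →ₐ[C] A) (hεφ : ∀ a, ε (φ a) = ε a) (Φ : Ω ≃ₐ[C] Ω)
    (hΦ : ∀ a, Φ (algebraMap A Ω a) = algebraMap A Ω (φ a)) :
    ∃ (P : Ideal S) (ρ : Ω ≃ₐ[C] Ω), P.IsMaximal ∧ (∀ a, algebraMap A S a ∈ P ↔ ε a = 0) ∧
      (∀ a, ρ (algebraMap A Ω a) = algebraMap A Ω (φ a)) ∧
      ∀ x y : S, algebraMap S Ω y = ρ (algebraMap S Ω x) → y - x ∈ P := by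
  have := IsIntegralClosure.isIntegral_algebra A (A := S) Ω
  have hinj := FaithfulSMul.algebraMap_injective S Ω
  have hAS : Function.Injective (algebraMap A S) := by
    have : Function.Injective (algebraMap A Ω) := by
      rw [IsScalarTower.algebraMap_eq A K Ω]
      exact (algebraMap K Ω).injective.comp (IsFractionRing.injective A K)
    rw [IsScalarTower.algebraMap_eq A S Ω] at this
    exact .of_comp this
  have : (RingHom.ker ε).IsMaximal := RingHom.ker_isMaximal_of_surjective _ fun c ↦
    ⟨algebraMap C A c, by simp⟩
  obtain ⟨P, hP, hPA⟩ := Ideal.exists_ideal_over_maximal_of_isIntegral (S := S) (RingHom.ker ε) (by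
    simp [(RingHom.injective_iff_ker_eq_bot _).mp hAS])
  have memP (a : A) : algebraMap A S a ∈ P ↔ ε a = 0 := by
    rw [← Ideal.mem_comap, hPA, RingHom.mem_ker]
  have hΦS (x : S) : ∃ y : S, algebraMap S Ω y = Φ (algebraMap S Ω x) := by
    refine IsIntegralClosure.isIntegral_iff (R := A).1 ?_
    exact ((IsIntegralClosure.isIntegral A Ω x).algebraMap (B := Ω)).map_of_comp_eq
      (φ : A →+* A) (Φ : Ω →+* Ω) (RingHom.ext fun a ↦ (hΦ a).symm)
  choose ΦS' hΦS' using hΦS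
  let ΦS : S →+* S :=
    { toFun := ΦS'
      map_one' := hinj (by simp [hΦS'])
      map_zero' := hinj (by simp [hΦS'])
      map_add' := fun x y ↦ hinj (by simp [hΦS'])
      map_mul' := fun x y ↦ hinj (by simp [hΦS']) }
  have hΦS (x : S) : algebraMap S Ω (ΦS x) = Φ (algebraMap S Ω x) := hΦS' x
  obtain ⟨g, hg⟩ := exists_algEquiv_of_under_eq (A := A) (K := K) (Ω := Ω) P (P.comap ΦS) (by
    ext a
    have : ΦS (algebraMap A S a) = algebraMap A S (φ a) := hinj (by
      rw [hΦS, ← IsScalarTower.algebraMap_apply, ← IsScalarTower.algebraMap_apply, hΦ])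
    simp only [Ideal.mem_comap, this, memP, hεφ, Ideal.under])
  have hgA (a : A) : g.symm (algebraMap A Ω a) = algebraMap A Ω a := by
    rw [IsScalarTower.algebraMap_apply A K Ω]; exact g.symm.commutes _
  have hgC (c : C) : g.symm (algebraMap C Ω c) = algebraMap C Ω c := by
    rw [IsScalarTower.algebraMap_apply C A Ω]; exact hgA _
  -- `g` carries the preimage of `P` under `Φ` to `P`, so `Φ ∘ g ⁻¹` preserves `P`.
  let ρ : Ω ≃ₐ[C] Ω := (AlgEquiv.ofRingEquiv (f := g.symm.toRingEquiv) hgC).trans Φ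
  have hρP (x y : S) (hx : x ∈ P) (hxy : algebraMap S Ω y = ρ (algebraMap S Ω x)) : y ∈ P := by
    have h1 : y = ΦS ((galRestrict A K Ω S g).symm x) := by
      apply hinj
      rw [hxy, hΦS]
      change Φ (g.symm (algebraMap S Ω x)) = _
      congr 1
      rw [AlgEquiv.symm_apply_eq]
      simpa using algebraMap_galRestrict_apply A (K := K) (L := Ω) g
        ((galRestrict A K Ω S g).symm x)
    rw [h1]
    exact (hg _).2 (by simpa using hx)
  refine ⟨P, ρ, hP, memP, fun a ↦ ?_, fun x y hxy ↦ ?_⟩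
  · rw [← hΦ]
    exact congrArg Φ (hgA a)
  · -- `S / P` is integral over the algebraically closed field `C`, so `x` is congruent to a
    -- constant, which `ρ` fixes.
    have := algebra_isIntegral_quotient_of_under_eq_ker ε P hPA
    obtain ⟨c, hc⟩ := IsAlgClosed.algebraMap_bijective_of_isIntegral (k := C) (K := S ⧸ P) |>.2
      (Ideal.Quotient.mk P x)
    have hc : x - algebraMap C S c ∈ P := Ideal.Quotient.eq.1 hc.symm
    have := hρP _ (y - algebraMap C S c) hc (by
      rw [map_sub, map_sub, map_sub, hxy, ← IsScalarTower.algebraMap_apply, ρ.commutes])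
    simpa using P.sub_mem this hc

/-- Two roots of `∏ (X - Z i) - d` that are congruent modulo `P` are equal: modulo `P` this
polynomial is `X ^ n - d`, which is separable. -/
theorem eq_of_root_of_sub_mem {S : Type*} [CommRing S] [IsDomain S] (P : Ideal S) [P.IsPrime]
    {n : ℕ} (hn : (n : S) ∉ P) (Z : Fin n → S) (hZ : ∀ i, Z i ∈ P) {d : S} (hd : d ∉ P) {x y : S}
    (hx : ∏ i, (x - Z i) = d) (hy : ∏ i, (y - Z i) = d) (hxy : y - x ∈ P) : y = x := by
  by_contra hne
  let f : S[X] := ∏ i, (X - C (Z i)) - C d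
  have heval (x : S) (hx : ∏ i, (x - Z i) = d) : f.eval x = 0 := by
    simp [f, eval_prod, hx]
  obtain ⟨q, hq⟩ := f.binomExpansion x (y - x)
  rw [add_sub_cancel, heval x hx, heval y hy, zero_add, sq, ← mul_assoc,
    ← add_mul, eq_comm, mul_eq_zero] at hq
  -- If `y ≠ x`, then dividing the Taylor expansion of `f` at `x` by `y - x` puts `f'(x)` into `P`.
  have hder : f.derivative.eval x ∈ P := by
    rcases hq with hq | hq
    · rw [add_eq_zero_iff_eq_neg] at hq
      rw [hq]
      exact P.neg_mem (P.mul_mem_left _ hxy)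
    · exact absurd (sub_eq_zero.1 hq) hne
  have hfP : f.map (Ideal.Quotient.mk P) = X ^ n - C (Ideal.Quotient.mk P d) := by
    have h0 (i) : Ideal.Quotient.mk P (Z i) = 0 := Ideal.Quotient.eq_zero_iff_mem.2 (hZ i)
    simp only [f, Polynomial.map_sub, Polynomial.map_prod, map_X, map_C, h0, map_zero, sub_zero,
      Finset.prod_const, Finset.card_univ, Fintype.card_fin]
  have hx0 := congrArg (Ideal.Quotient.mk P) (heval x hx)
  rw [← eval_map_apply, hfP] at hx0
  rw [← Ideal.Quotient.eq_zero_iff_mem, ← eval_map_apply, ← derivative_map, hfP] at hder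
  rw [← Ideal.Quotient.eq_zero_iff_mem] at hn hd
  have hn0 : n ≠ 0 := by rintro rfl; simp at hn
  simp only [derivative_sub, derivative_X_pow, derivative_C, sub_zero, eval_mul, eval_C, eval_pow,
    eval_X, eval_sub, eval_natCast, map_zero, mul_eq_zero, map_natCast,
    pow_eq_zero_iff'] at hder hx0 hn
  rcases hder with h | h
  · exact hn h
  · rw [h.1, zero_pow hn0, zero_sub, neg_eq_zero] at hx0
    exact hd hx0

open scoped IntermediateField.algebraAdjoinAdjoin in
/-- Every permutation of a transcendence basis `z` is induced by an automorphism that fixes all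
roots of the polynomials `∏ (X - z i) - δ` with `δ ≠ 0` a constant. -/
theorem exists_algEquiv_perm_roots {C Ω : Type*} [Field C] [IsAlgClosed C] [CharZero C] [Field Ω]
    [IsAlgClosed Ω] [Algebra C Ω] {n : ℕ} {z : Fin n → Ω} (hz : IsTranscendenceBasis C z)
    (τ : Equiv.Perm (Fin n)) :
    ∃ ρ : Ω ≃ₐ[C] Ω, (∀ i, ρ (z i) = z (τ i)) ∧
      ∀ δ : C, δ ≠ 0 → ∀ y : Ω, ∏ i, (y - z i) = algebraMap C Ω δ → ρ y = y := by
  rcases Nat.eq_zero_or_pos n with rfl | hn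
  · exact ⟨.refl, fun i ↦ i.elim0, fun _ _ _ _ ↦ rfl⟩
  have : CharZero Ω := charZero_of_injective_algebraMap (algebraMap C Ω).injective
  let A := Algebra.adjoin C (Set.range z)
  let K := IntermediateField.adjoin C (Set.range z)
  let e : MvPolynomial (Fin n) C ≃ₐ[C] A := hz.1.aevalEquiv
  have he (i) : algebraMap A Ω (e (.X i)) = z i :=
    (hz.1.algebraMap_aevalEquiv (.X i)).trans (MvPolynomial.aeval_X ..)
  have : IsIntegrallyClosed A := .of_equiv e.toRingEquiv
  have : Algebra.IsAlgebraic K Ω := hz.isAlgebraic_field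
  have : Algebra.IsAlgebraic A Ω := hz.isAlgebraic
  have : IsAlgClosure K Ω := ⟨inferInstance, inferInstance⟩
  have : IsGalois K Ω := ⟨⟩
  let S := integralClosure A Ω
  have : IsFractionRing S Ω := integralClosure.isFractionRing_of_algebraic
    ((injective_iff_map_eq_zero _).1 Subtype.val_injective)
  obtain ⟨Φ₀, hΦC, hΦ⟩ := exists_ringEquiv_of_isTranscendenceBasis (RingEquiv.refl C) hz
    ((isTranscendenceBasis_equiv τ (f := z)).2 hz)
  let Φ : Ω ≃ₐ[C] Ω := .ofRingEquiv (f := Φ₀) hΦC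
  replace hΦ (i) : Φ (z i) = z (τ i) := hΦ i
  -- The evaluation at the origin, and the endomorphism of `A` that permutes the coordinates.
  let ε : A →ₐ[C] C := (MvPolynomial.aeval 0).comp e.symm.toAlgHom
  have hε (i) : ε (e (.X i)) = 0 := by simp [ε]
  let φ : A →ₐ[C] A := (e.toAlgHom.comp (MvPolynomial.rename τ)).comp e.symm.toAlgHom
  have hφ (i) : φ (e (.X i)) = e (.X (τ i)) := by simp [φ]
  have hεφ (a) : ε (φ a) = ε a := by
    obtain ⟨p, rfl⟩ := e.surjective a
    have : (ε.comp φ).comp e.toAlgHom = ε.comp e.toAlgHom := by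
      ext i
      simp [hφ, hε]
    exact DFunLike.congr_fun this p
  have hΦφ (a) : Φ (algebraMap A Ω a) = algebraMap A Ω (φ a) := by
    obtain ⟨p, rfl⟩ := e.surjective a
    have : (Φ.toAlgHom.comp A.val).comp e.toAlgHom = ((A.val.comp φ).comp e.toAlgHom) := by
      ext i
      have := he i
      have := he (τ i)
      simp_all
    exact DFunLike.congr_fun this p
  obtain ⟨P, ρ, hP, memP, hρA, hρP⟩ :=
    exists_algEquiv_congr_mod_maximal (S := S) K ε φ hεφ Φ hΦφ
  have hρz (i) : ρ (z i) = z (τ i) := by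
    rw [← he, hρA, hφ, he]
  refine ⟨ρ, hρz, fun δ hδ y hy ↦ ?_⟩
  have root_int (y : Ω) (hy : ∏ i, (y - z i) = algebraMap C Ω δ) : y ∈ S := by
    refine ⟨∏ i, (X - Polynomial.C (e (.X i))) - Polynomial.C (algebraMap C A δ), ?_, ?_⟩
    · refine (monic_prod_X_sub_C _ _).sub_of_left (degree_C_le.trans_lt ?_)
      rw [degree_eq_natDegree (monic_prod_X_sub_C _ _).ne_zero,
        natDegree_finsetProd_X_sub_C_eq_card]
      simpa using hn
    · rw [← aeval_def, map_sub, map_prod]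
      simp [he, hy, ← IsScalarTower.algebraMap_apply]
  have hy' : ∏ i, (ρ y - z i) = algebraMap C Ω δ := by
    rw [← ρ.commutes, ← hy, map_prod]
    simp only [map_sub, hρz]
    exact (Equiv.prod_comp τ fun i ↦ (ρ y - z i)).symm
  have memPC (c : C) (hc : c ≠ 0) : algebraMap C S c ∉ P := by
    rw [IsScalarTower.algebraMap_apply C A S, memP]
    simpa using hc
  have hprod (x : S) (hx : ∏ i, ((x : Ω) - z i) = algebraMap C Ω δ) :
      ∏ i, (x - algebraMap A S (e (.X i))) = algebraMap C S δ := by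
    apply FaithfulSMul.algebraMap_injective S Ω
    rw [map_prod, ← IsScalarTower.algebraMap_apply, ← hx]
    refine Finset.prod_congr rfl fun i _ ↦ ?_
    rw [map_sub, ← IsScalarTower.algebraMap_apply, he]
    rfl
  exact congrArg Subtype.val (eq_of_root_of_sub_mem P
    (by simpa using memPC n (by exact_mod_cast hn.ne')) _ (fun i ↦ (memP _).2 (hε i)) (memPC δ hδ)
    (hprod ⟨y, root_int y hy⟩ hy) (hprod ⟨ρ y, root_int _ hy'⟩ hy') (hρP _ _ rfl))

/-! ### Monic polynomials with given coefficients -/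

/-- The monic polynomial `X ^ n + t 0 X ^ (n - 1) + ⋯ + t (n - 1)`; the exponent of the term with
coefficient `t v` is `n - (v + 1)`, where `v` is counted from `0`. -/
noncomputable def monicOfCoeffs {R : Type*} [CommRing R] {n : ℕ} (t : Fin n → R) : R[X] :=
  X ^ n + ∑ v : Fin n, C (t v) * X ^ (n - ((v : ℕ) + 1))

theorem monicOfCoeffs_map {R S : Type*} [CommRing R] [CommRing S] (f : R →+* S) {n : ℕ}
    (t : Fin n → R) : (monicOfCoeffs t).map f = monicOfCoeffs (f ∘ t) := by
  simp [monicOfCoeffs, Polynomial.map_sum]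

theorem degree_sum_C_mul_X_pow_lt {R : Type*} [CommRing R] {n : ℕ} (t : Fin n → R) :
    (∑ v : Fin n, C (t v) * X ^ (n - ((v : ℕ) + 1))).degree < (n : WithBot ℕ) := by
  refine (degree_sum_le _ _).trans_lt ((Finset.sup_lt_iff (WithBot.bot_lt_coe n)).2 fun v _ ↦ ?_)
  refine (degree_C_mul_X_pow_le _ _).trans_lt ?_
  exact Nat.cast_lt.2 (by omega)

theorem monicOfCoeffs_monic {R : Type*} [CommRing R] {n : ℕ} (t : Fin n → R) :
    (monicOfCoeffs t).Monic :=
  monic_X_pow_add (degree_sum_C_mul_X_pow_lt t)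

theorem monicOfCoeffs_natDegree {R : Type*} [CommRing R] [Nontrivial R] {n : ℕ} (t : Fin n → R) :
    (monicOfCoeffs t).natDegree = n :=
  natDegree_eq_of_degree_eq_some (by
    rw [monicOfCoeffs, degree_add_eq_left_of_degree_lt, degree_X_pow]
    rw [degree_X_pow]
    exact degree_sum_C_mul_X_pow_lt t)

theorem monicOfCoeffs_coeff {R : Type*} [CommRing R] {n : ℕ} (t : Fin n → R) (v : Fin n) :
    (monicOfCoeffs t).coeff (n - ((v : ℕ) + 1)) = t v := by
  have h (w : Fin n) : n - ((v : ℕ) + 1) = n - ((w : ℕ) + 1) ↔ w = v := by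
    rw [Fin.ext_iff]; omega
  have h' : n - ((v : ℕ) + 1) ≠ n := by omega
  simp [monicOfCoeffs, coeff_X_pow, h, h']

/-- If the coefficients form a transcendence basis, then so do the roots, even after the constant
coefficient has been shifted by a constant: there are as many roots as coefficients, and the
coefficients are polynomials in the roots. -/
theorem isTranscendenceBasis_roots {C Ω : Type*} [Field C] [Field Ω] [Algebra C Ω] {n : ℕ}
    {t z : Fin n → Ω} (ht : IsTranscendenceBasis C t) (b : C)
    (hz : ∏ i, (X - Polynomial.C (z i)) = monicOfCoeffs t - Polynomial.C (algebraMap C Ω b)) :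
    IsTranscendenceBasis C z := by
  let A := Algebra.adjoin C (Set.range z)
  have htA : Set.range t ⊆ A := by
    rintro _ ⟨v, rfl⟩
    have hp : (∏ i, (X - Polynomial.C (⟨z i, Algebra.subset_adjoin ⟨i, rfl⟩⟩ : A)) +
        Polynomial.C (algebraMap C A b)).map (algebraMap A Ω) = monicOfCoeffs t := by
      rw [← sub_add_cancel (monicOfCoeffs t) (Polynomial.C (algebraMap C Ω b)), ← hz,
        Polynomial.map_add, Polynomial.map_prod]
      simp [← IsScalarTower.algebraMap_apply]
    rw [← monicOfCoeffs_coeff t v, ← hp, coeff_map]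
    exact Subtype.property _
  have : Algebra.IsAlgebraic (Algebra.adjoin C (Set.range t)) Ω := ht.isAlgebraic
  have : Algebra.IsAlgebraic (Algebra.adjoin C (Set.range z)) Ω := by
    let i := Subalgebra.inclusion (Algebra.adjoin_le htA)
    refine ⟨fun x ↦ ?_⟩
    let := i.toRingHom.toAlgebra
    have : IsScalarTower (Algebra.adjoin C (Set.range t)) A Ω := .of_algebraMap_eq fun _ ↦ rfl
    exact (Algebra.IsAlgebraic.isAlgebraic (R := Algebra.adjoin C (Set.range t)) x).extendScalars
      (Subalgebra.inclusion_injective (Algebra.adjoin_le htA))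
  refine Algebra.IsAlgebraic.isTranscendenceBasis_of_lift_le_trdeg_of_finite C z ?_
  rw [← ht.lift_cardinalMk_eq_trdeg]

theorem apply_coeff_eq_of_perm_roots {Ω : Type*} [Field Ω] {n : ℕ} {t z : Fin n → Ω} {b : Ω}
    (hz : ∏ i, (X - Polynomial.C (z i)) = monicOfCoeffs t - Polynomial.C b) (Φ : Ω →+* Ω)
    (hb : Φ b = b) (τ : Equiv.Perm (Fin n)) (hΦ : ∀ i, Φ (z i) = z (τ i)) (v : Fin n) :
    Φ (t v) = t v := by
  have h := congrArg (Polynomial.map Φ) hz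
  rw [Polynomial.map_prod, Polynomial.map_sub, monicOfCoeffs_map, map_C, hb] at h
  simp only [Polynomial.map_sub, map_X, map_C, hΦ] at h
  rw [Equiv.prod_comp τ fun i ↦ (X - Polynomial.C (z i)), hz, sub_left_inj] at h
  simpa only [monicOfCoeffs_coeff] using! (congrArg (coeff · (n - ((v : ℕ) + 1))) h).symm

theorem exists_algEquiv_of_adjoin_eq_top {L' L Ω : Type*} [Field L'] [Field L] [Field Ω]
    [Algebra L' L] [Algebra L Ω] {s : Set L}
    (hs : IntermediateField.adjoin L' s = ⊤) (Φ : Ω ≃+* Ω)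
    (hL' : ∀ a : L', Φ (algebraMap L Ω (algebraMap L' L a)) = algebraMap L Ω (algebraMap L' L a))
    (hΦ : ∀ a ∈ s, Φ (algebraMap L Ω a) = algebraMap L Ω a) :
    ∃ φ : Ω ≃ₐ[L] Ω, ∀ x, φ x = Φ x := by
  refine ⟨.ofRingEquiv (f := Φ) fun a ↦ ?_, fun _ ↦ rfl⟩
  have ha : a ∈ IntermediateField.adjoin L' s := hs ▸ IntermediateField.mem_top
  induction ha using IntermediateField.adjoin_induction with
  | mem a h => exact hΦ a h
  | algebraMap a => exact hL' a
  | add a b _ _ ha hb => simp [ha, hb]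
  | inv a _ ha => simp [ha]
  | mul a b _ _ ha hb => simp [ha, hb]

theorem exists_prod_X_sub_C_eq {Ω : Type*} [Field Ω] [IsAlgClosed Ω] {p : Polynomial Ω}
    (hp : p.Monic) {n : ℕ} (hn : p.natDegree = n) : ∃ z : Fin n → Ω, ∏ i, (X - Polynomial.C (z i)) = p := by
  have hs := IsAlgClosed.splits p
  have hc : p.roots.card = n := by rw [← hn, hs.natDegree_eq_card_roots]
  obtain ⟨l, hl⟩ : ∃ l : List Ω, (l : Multiset Ω) = p.roots := Quot.exists_rep _
  subst hc
  have h := hs.eq_prod_roots_of_monic hp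
  rw [← hl, Multiset.map_coe, Multiset.prod_coe] at h
  rw [← hl, Multiset.coe_card]
  exact ⟨l.get, by
    rw [h, ← List.prod_ofFn]
    conv_rhs => rw [← List.ofFn_get l, List.map_ofFn]
    rfl⟩

/-! ### The composite with a generic polynomial -/

/-- The injective family `r` enumerates the roots of `F` in `Ω`, and `W` is the group of those
permutations of the index set that are induced by automorphisms of `Ω` over `L`. For `Ω` an
algebraic closure of `L` and `F ≠ 0`, this says that `W` is the Galois group of `F` as a permutation
group. -/
structure IsGaloisLabelling {L Ω ι : Type*} [Field L] [Field Ω] [Algebra L Ω] (F : Polynomial L)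
    (r : ι → Ω) (W : Subgroup (Equiv.Perm ι)) : Prop where
  injective : Function.Injective r
  aeval_eq_zero_iff : ∀ x, aeval x F = 0 ↔ x ∈ Set.range r
  mem_iff : ∀ π, π ∈ W ↔ ∃ φ : Ω ≃ₐ[L] Ω, ∀ i, φ (r i) = r (π i)

/-- The roots of the polynomials `g - β j` can be permuted independently of each other, with the
coefficients of `g` fixed. -/
theorem exists_algEquiv_perm_blocks {C Ω : Type*} [Field C] [IsAlgClosed C] [CharZero C] [Field Ω]
    [IsAlgClosed Ω] [Algebra C Ω] {n : ℕ} {t : Fin n → Ω} (ht : IsTranscendenceBasis C t)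
    {ι : Type*} [Finite ι] {β : ι → C} (hβ : Function.Injective β) {z : ι → Fin n → Ω}
    (hz : ∀ j, ∏ i, (X - Polynomial.C (z j i)) =
      monicOfCoeffs t - Polynomial.C (algebraMap C Ω (β j)))
    (σ : ι → Equiv.Perm (Fin n)) :
    ∃ ρ : Ω ≃ₐ[C] Ω, (∀ v, ρ (t v) = t v) ∧ ∀ j i, ρ (z j i) = z j (σ j i) := by
  classical
  have := Fintype.ofFinite ι
  have key (s : Finset ι) : ∃ ρ : Ω ≃ₐ[C] Ω, (∀ v, ρ (t v) = t v) ∧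
      ∀ j i, ρ (z j i) = if j ∈ s then z j (σ j i) else z j i := by
    induction s using Finset.induction_on with
    | empty => exact ⟨.refl, by simp⟩
    | insert a s ha ih =>
      obtain ⟨ρ, hρt, hρ⟩ := ih
      obtain ⟨ρ', hρ', hρ''⟩ :=
        exists_algEquiv_perm_roots (isTranscendenceBasis_roots ht _ (hz a)) (σ a)
      have hfix (j) (hj : j ≠ a) (i) : ρ' (z j i) = z j i := by
        refine hρ'' (β j - β a) (sub_ne_zero.2 (hβ.ne hj)) _ ?_
        have h1 := congrArg (eval (z j i)) (hz a)
        have h2 := congrArg (eval (z j i)) (hz j)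
        rw [eval_prod, Finset.prod_eq_zero (Finset.mem_univ i) (by simp)] at h2
        simp only [eval_prod, eval_sub, eval_X, eval_C] at h1 h2
        rw [h1, map_sub, ← sub_eq_zero.1 h2.symm]
      refine ⟨ρ.trans ρ', fun v ↦ ?_, fun j i ↦ ?_⟩
      · rw [AlgEquiv.trans_apply, hρt]
        exact apply_coeff_eq_of_perm_roots (hz a) (ρ' : Ω →+* Ω) (ρ'.commutes _) (σ a) hρ' v
      · rw [AlgEquiv.trans_apply, hρ]
        by_cases hj : j = a
        · subst hj
          simp [ha, hρ']
        · simp only [Finset.mem_insert, hj, false_or]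
          split_ifs
          · exact hfix j hj _
          · exact hfix j hj _
  simpa using key Finset.univ

theorem exists_perm_of_forall_exists {α : Type*} [Finite α] {X Y : Type*} {f : α → X} {g : α → Y}
    (hf : Function.Injective f) {Φ : X → Y} (hΦ : Function.Injective Φ)
    (h : ∀ i, ∃ k, Φ (f i) = g k) : ∃ ν : Equiv.Perm α, ∀ i, Φ (f i) = g (ν i) := by
  choose ν hν using h
  have hinj : Function.Injective ν := fun a b hab ↦
    hf (hΦ (by rw [hν, hν, hab]))
  exact ⟨.ofBijective ν (Finite.injective_iff_bijective.1 hinj), hν⟩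

/-- If `G` has Galois group `H` over `L'`, and `g` is the polynomial with generic coefficients `t`,
then `G(g(x))` has Galois group `S_n ≀ H` over `L'(t)`. -/
theorem IsGaloisLabelling.comp_monicOfCoeffs {L' L Ω : Type*} [Field L'] [CharZero L'] [Field L]
    [Field Ω] [IsAlgClosed Ω] [Algebra L' L] [Algebra L Ω] [Algebra L' Ω] [IsScalarTower L' L Ω]
    [Algebra.IsAlgebraic L Ω] {n : ℕ} (hn : n ≠ 0) {t : Fin n → L} (ht : AlgebraicIndependent L' t)
    (htop : IntermediateField.adjoin L' (Set.range t) = ⊤) {ι : Type*} [Finite ι]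
    {G : Polynomial L'} (hG : G ≠ 0) {β : ι → algebraicClosure L' Ω}
    {H : Subgroup (Equiv.Perm ι)} (h : IsGaloisLabelling G β H) :
    ∃ r : Fin n × ι → Ω, IsGaloisLabelling ((G.map (algebraMap L' L)).comp (monicOfCoeffs t)) r
      (wreath ⊤ H) := by
  let C := algebraicClosure L' Ω
  have : IsAlgClosure L' C := algebraicClosure.isAlgClosure L' Ω
  have : IsAlgClosed C := IsAlgClosure.isAlgClosed L'
  have : CharZero C := charZero_of_injective_algebraMap (algebraMap L' C).injective
  let tΩ : Fin n → Ω := algebraMap L Ω ∘ t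
  have htC : IsTranscendenceBasis C tΩ := by
    rw [← Algebra.IsAlgebraic.isTranscendenceBasis_iff L' C]
    refine IsTranscendenceBasis.algebraMap_comp ?_
    rw [ht.isTranscendenceBasis_iff_isAlgebraic, ← IntermediateField.isAlgebraic_adjoin_iff_top,
      htop]
    exact ⟨fun x ↦ isAlgebraic_algebraMap (⟨x, trivial⟩ : (⊤ : IntermediateField L' L))⟩
  have hg : (monicOfCoeffs t).map (algebraMap L Ω) = monicOfCoeffs tΩ := monicOfCoeffs_map ..
  have hz (j : ι) : ∃ z : Fin n → Ω, ∏ i, (X - Polynomial.C (z i)) =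
      monicOfCoeffs tΩ - Polynomial.C (algebraMap C Ω (β j)) := by
    refine exists_prod_X_sub_C_eq ((monicOfCoeffs_monic tΩ).sub_of_left
      (degree_C_le.trans_lt ?_)) ?_
    · rw [degree_eq_natDegree (monicOfCoeffs_monic tΩ).ne_zero, monicOfCoeffs_natDegree]
      simpa using Nat.pos_of_ne_zero hn
    · rw [natDegree_sub_C, monicOfCoeffs_natDegree]
  choose z hz using hz
  have hzinj (j) : Function.Injective (z j) :=
    (isTranscendenceBasis_roots htC _ (hz j)).1.injective
  have hroot (j : ι) (x : Ω) : (monicOfCoeffs tΩ).eval x = β j ↔ ∃ i, x = z j i := by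
    rw [← sub_eq_zero]
    have := congrArg (eval x) (hz j)
    rw [eval_sub, eval_C] at this
    change _ = eval x (monicOfCoeffs tΩ) - β j at this
    rw [← this, eval_prod, Finset.prod_eq_zero_iff]
    simp [sub_eq_zero]
  have hzr (j i) : (monicOfCoeffs tΩ).eval (z j i) = β j := (hroot j _).2 ⟨i, rfl⟩
  have hblock {j j' i i'} (he : z j i = z j' i') : j = j' :=
    h.injective (Subtype.val_injective (by rw [← hzr j i, he, hzr]))
  have hGroot (y : Ω) : aeval y G = 0 ↔ ∃ j, (β j : Ω) = y := by
    constructor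
    · intro hy
      have hyC : y ∈ C := mem_algebraicClosure_iff.2 ⟨G, hG, hy⟩
      lift y to C using hyC
      have : aeval y G = 0 := Subtype.val_injective (by simpa using hy)
      obtain ⟨j, hj⟩ := (h.aeval_eq_zero_iff y).1 this
      exact ⟨j, congrArg _ hj⟩
    · rintro ⟨j, rfl⟩
      have := (h.aeval_eq_zero_iff (β j)).2 ⟨j, rfl⟩
      simpa using congrArg (algebraMap C Ω) this
  have hφg (φ : Ω ≃ₐ[L] Ω) (x : Ω) :
      φ ((monicOfCoeffs tΩ).eval x) = (monicOfCoeffs tΩ).eval (φ x) := by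
    rw [← hg, eval_map_algebraMap, eval_map_algebraMap, aeval_algHom_apply]
  refine ⟨fun q ↦ z q.2 q.1, ⟨?_, fun x ↦ ?_, fun π ↦ ⟨?_, ?_⟩⟩⟩
  · rintro ⟨i, j⟩ ⟨i', j'⟩ he
    obtain rfl := hblock he
    exact congrArg (·, j) (hzinj j he)
  · rw [aeval_comp, aeval_map_algebraMap, ← eval_map_algebraMap (monicOfCoeffs t) x, hg, hGroot]
    simp_rw [eq_comm (a := (_ : Ω)) (b := eval x _), hroot]
    constructor
    · rintro ⟨j, i, rfl⟩; exact ⟨(i, j), rfl⟩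
    · rintro ⟨⟨i, j⟩, rfl⟩; exact ⟨j, i, rfl⟩
  · rintro ⟨σ, -, p, hp, hπ⟩
    obtain ⟨θ, hθ⟩ := (h.mem_iff p).1 hp
    obtain ⟨Φ, hΦC, hΦt⟩ := exists_ringEquiv_of_isTranscendenceBasis θ.toRingEquiv htC htC
    obtain ⟨φ, hφ⟩ := exists_algEquiv_of_adjoin_eq_top htop Φ (fun a ↦ by
      rw [← IsScalarTower.algebraMap_apply, IsScalarTower.algebraMap_apply L' C Ω, hΦC]
      congr 1
      exact θ.commutes a) (by rintro _ ⟨v, rfl⟩; exact hΦt v)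
    have hφβ (j) : φ (β j) = β (p j) := by
      rw [hφ, ← hθ]
      exact hΦC (β j)
    have hν (j) : ∃ ν : Equiv.Perm (Fin n), ∀ i, φ (z j i) = z (p j) (ν i) :=
      exists_perm_of_forall_exists (hzinj j) φ.injective fun i ↦
        (hroot _ _).1 (by rw [← hφg, hzr, hφβ])
    choose ν hν using hν
    -- `φ` induces the right permutation `p` of the blocks; the permutations `ν j` that it induces
    -- inside the blocks are corrected by an automorphism that preserves every block.
    obtain ⟨ρ, hρt, hρ⟩ := exists_algEquiv_perm_blocks htC h.injective hz
      (fun j ↦ σ (p.symm j) * (ν (p.symm j))⁻¹)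
    obtain ⟨ψ, hψ⟩ := exists_algEquiv_of_adjoin_eq_top htop ρ.toRingEquiv (fun a ↦ by
      rw [← IsScalarTower.algebraMap_apply, IsScalarTower.algebraMap_apply L' C Ω]
      exact ρ.commutes _) (by rintro _ ⟨v, rfl⟩; exact hρt v)
    refine ⟨φ.trans ψ, fun ⟨i, j⟩ ↦ ?_⟩
    rw [hπ, AlgEquiv.trans_apply, hν, hψ]
    refine (hρ _ _).trans ?_
    simp
  · -- `φ` restricts to `C`, where it permutes the `β j`.
    rintro ⟨φ, hφ⟩
    let θ : C ≃ₐ[L'] C := (φ.restrictScalars L').restrictNormal C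
    have hθ (c : C) : (θ c : Ω) = φ c := (φ.restrictScalars L').restrictNormal_commutes C c
    obtain ⟨p, hp⟩ := exists_perm_of_forall_exists h.injective θ.injective (g := β) fun j ↦ by
      obtain ⟨k, hk⟩ := (h.aeval_eq_zero_iff (θ (β j))).1 (by
        rw [aeval_algHom_apply, (h.aeval_eq_zero_iff _).2 ⟨j, rfl⟩, map_zero])
      exact ⟨k, hk.symm⟩
    have hπ (i j) : (π (i, j)).2 = p j := by
      apply h.injective
      apply Subtype.val_injective
      rw [← hp, hθ, ← hzr _ (π (i, j)).1, ← hφ (i, j), ← hφg, hzr]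
    have hσ (j) : ∃ ν : Equiv.Perm (Fin n), ∀ i, φ (z j i) = z (p j) (ν i) :=
      exists_perm_of_forall_exists (hzinj j) φ.injective fun i ↦
        ⟨(π (i, j)).1, by rw [← hπ i j]; exact hφ (i, j)⟩
    choose σ hσ using hσ
    refine ⟨σ, fun _ ↦ trivial, p, (h.mem_iff p).2 ⟨θ, hp⟩, fun i j ↦ Prod.ext ?_ (hπ i j)⟩
    apply hzinj (p j)
    rw [← hσ, ← hπ i j]
    exact (hφ (i, j)).symm

/-! ### Iterated composites and iterated wreath products -/

theorem iterComp_map {R S : Type*} [CommRing R] [CommRing S] (f : R →+* S) :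
    ∀ (k : ℕ) (g : Fin k → R[X]), (iterComp k g).map f = iterComp k fun u ↦ (g u).map f
  | 0, _ => Polynomial.map_X f
  | k + 1, g => by
    rw [iterComp, Polynomial.map_comp, iterComp_map f k]
    rfl

theorem iterComp_monic {R : Type*} [CommRing R] [IsDomain R] :
    ∀ (k : ℕ) (g : Fin k → R[X]), (∀ u, (g u).Monic) → (∀ u, (g u).natDegree ≠ 0) →
      (iterComp k g).Monic
  | 0, _, _, _ => monic_X
  | k + 1, g, hg, hg0 =>
    (iterComp_monic k (Fin.tail g) (fun u ↦ hg u.succ) fun u ↦ hg0 u.succ).comp (hg 0) (hg0 0)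

theorem iterComp_natDegree {R : Type*} [CommRing R] [IsDomain R] :
    ∀ (k : ℕ) (g : Fin k → R[X]), (iterComp k g).natDegree = ∏ u, (g u).natDegree
  | 0, _ => natDegree_X
  | k + 1, g => by
    rw [iterComp, natDegree_comp, iterComp_natDegree k, Fin.prod_univ_succ, mul_comm]
    rfl

instance finite_index : ∀ (k : ℕ) (n : Fin k → ℕ), Finite (Index k n)
  | 0, _ => inferInstanceAs (Finite Unit)
  | 1, n => inferInstanceAs (Finite (Fin (n 0)))
  | k + 2, n =>
    have := finite_index (k + 1) (Fin.tail n)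
    inferInstanceAs (Finite (Fin (n 0) × Index (k + 1) (Fin.tail n)))

theorem card_index : ∀ (k : ℕ) (n : Fin k → ℕ), Nat.card (Index k n) = ∏ u, n u
  | 0, _ => Nat.card_unique (α := Unit)
  | 1, n => by simp [Index]
  | k + 2, n => by
    rw [Fin.prod_univ_succ]
    exact (Nat.card_prod _ _).trans
      (congrArg₂ (· * ·) (Nat.card_fin _) (card_index (k + 1) (Fin.tail n)))

theorem exists_mem_symWreath_apply_eq :
    ∀ (k : ℕ) (n : Fin k → ℕ) (i j : Index k n), ∃ π ∈ symWreath k n, π i = j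
  | 0, _, i, j => ⟨1, trivial, Subsingleton.elim (α := Unit) _ _⟩
  | 1, n, i, j => by
    classical exact ⟨Equiv.swap i j, trivial, Equiv.swap_apply_left _ _⟩
  | k + 2, n, (i, i'), (j, j') => by
    obtain ⟨π, hπ, hij⟩ := exists_mem_symWreath_apply_eq (k + 1) (Fin.tail n) i' j'
    exact ⟨Equiv.prodCongr (Equiv.swap i j) π,
      ⟨fun _ ↦ Equiv.swap i j, fun _ ↦ trivial, π, hπ, fun _ _ ↦ rfl⟩,
      Prod.ext (Equiv.swap_apply_left _ _) hij⟩

/-- The wreath product of the symmetric group with the trivial group of a point is the symmetric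
group. It is needed because `symWreath 1 n` acts on `Fin (n 0)` and not on `Fin (n 0) × Unit`. -/
theorem IsGaloisLabelling.of_prod_unit {L Ω α : Type*} [Field L] [Field Ω] [Algebra L Ω]
    {F : L[X]} {r : α × Unit → Ω} (hr : IsGaloisLabelling F r (wreath ⊤ ⊤)) :
    IsGaloisLabelling F (fun i ↦ r (i, ())) ⊤ := by
  let e : α ≃ α × Unit := (Equiv.prodPUnit α).symm
  refine ⟨hr.injective.comp e.injective, fun x ↦ ?_, fun π ↦ iff_of_true trivial ?_⟩
  · rw [hr.aeval_eq_zero_iff, ← e.surjective.range_comp]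
    rfl
  · obtain ⟨φ, hφ⟩ := (hr.mem_iff (e.permCongr π)).1
      ⟨fun _ ↦ π, fun _ ↦ trivial, 1, trivial, fun i j ↦ rfl⟩
    exact ⟨φ, fun i ↦ hφ _⟩

theorem IsGaloisLabelling.exists_symWreath_succ {L Ω : Type*} [Field L] [Field Ω] [Algebra L Ω]
    {F : L[X]} : ∀ {k : ℕ} {n : Fin (k + 1) → ℕ} {r : Fin (n 0) × Index k (Fin.tail n) → Ω},
      IsGaloisLabelling F r (wreath ⊤ (symWreath k (Fin.tail n))) →
      ∃ r' : Index (k + 1) n → Ω, IsGaloisLabelling F r' (symWreath (k + 1) n)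
  | 0, _, _, hr => ⟨_, hr.of_prod_unit⟩
  | _ + 1, _, _, hr => ⟨_, hr⟩

/-- The theorem for a field `L = K(T)` generated by algebraically independent elements. The field
`L` varies in the induction, which passes to the subfield generated by the coefficients of all but
the innermost polynomial. -/
theorem exists_isGaloisLabelling_iterComp (K : Type*) [Field K] [CharZero K] :
    ∀ (k : ℕ) (n : Fin k → ℕ), (∀ u, n u ≠ 0) → ∀ (L : Type u) [Field L] [Algebra K L]
      (T : (Σ u, Fin (n u)) → L), AlgebraicIndependent K T →
      IntermediateField.adjoin K (Set.range T) = ⊤ →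
      ∀ (Ω : Type v) [Field Ω] [Algebra L Ω] [IsAlgClosure L Ω],
      ∃ r : Index k n → Ω, IsGaloisLabelling
        (iterComp k fun u ↦ monicOfCoeffs fun v ↦ T ⟨u, v⟩) r (symWreath k n) := by
  intro k
  induction k with
  | zero =>
    intro n _ L _ _ T _ _ Ω _ _ _
    refine ⟨fun _ ↦ 0, fun _ _ _ ↦ Subsingleton.elim (α := Unit) _ _, fun x ↦ ?_, fun π ↦ ?_⟩
    · have : Nonempty (Index 0 n) := inferInstanceAs (Nonempty Unit)
      simp [iterComp]
    · exact iff_of_true trivial ⟨.refl, fun _ ↦ rfl⟩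
  | succ k ih =>
    intro n hn L _ _ T hT htop Ω _ _ _
    have : IsAlgClosed Ω := IsAlgClosure.isAlgClosed L
    let f : (Σ u : Fin k, Fin (Fin.tail n u)) → Σ u, Fin (n u) :=
      Sigma.map Fin.succ fun _ ↦ id
    have hf : Function.Injective f :=
      (Fin.succ_injective k).sigma_map fun _ ↦ Function.injective_id
    let L' := IntermediateField.adjoin K (T '' Set.range f)
    let T' (q) : L' := ⟨T (f q), IntermediateField.subset_adjoin _ _ ⟨_, ⟨q, rfl⟩, rfl⟩⟩
    have hT' : AlgebraicIndependent K T' :=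
      (L'.val.algebraicIndependent_iff L'.val.injective).1 (hT.comp f hf)
    have htop' : IntermediateField.adjoin K (Set.range T') = ⊤ := by
      apply IntermediateField.map_injective L'.val
      rw [IntermediateField.adjoin_map, ← Set.range_comp, ← AlgHom.fieldRange_eq_map,
        IntermediateField.fieldRange_val]
      exact congrArg _ (Set.range_comp T f)
    have := charZero_of_injective_algebraMap (algebraMap K L').injective
    have := algebraicClosure.isAlgClosure L' Ω
    obtain ⟨β, hβ⟩ := ih (Fin.tail n) (fun u ↦ hn u.succ) L' T' hT' htop' (algebraicClosure L' Ω)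
    have ht : AlgebraicIndependent L' fun v ↦ T ⟨0, v⟩ := by
      rw [IntermediateField.algebraicIndependent_adjoin_iff]
      refine (hT.adjoin_of_disjoint (s := Set.range f) (t := Set.range (Sigma.mk 0)) ?_).comp
        (fun v ↦ ⟨_, v, rfl⟩) fun v v' h ↦
          sigma_mk_injective (i := (0 : Fin (k + 1))) (congrArg Subtype.val h)
      rw [Set.disjoint_left]
      rintro _ ⟨q, rfl⟩ ⟨v, h⟩
      exact Fin.succ_ne_zero _ (congrArg Sigma.fst h).symm
    have httop : IntermediateField.adjoin L' (Set.range fun v ↦ T ⟨0, v⟩) = ⊤ := by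
      apply IntermediateField.restrictScalars_injective K
      rw [IntermediateField.adjoin_adjoin_left, IntermediateField.restrictScalars_top, eq_top_iff,
        ← htop]
      refine IntermediateField.adjoin.mono _ _ _ ?_
      rintro _ ⟨⟨u, v⟩, rfl⟩
      induction u using Fin.cases with
      | zero => exact .inr ⟨v, rfl⟩
      | succ u => exact .inl ⟨_, ⟨⟨u, v⟩, rfl⟩, rfl⟩
    obtain ⟨r, hr⟩ := hβ.comp_monicOfCoeffs (L := L) (hn 0) ht httop (iterComp_monic _ _
      (fun u ↦ monicOfCoeffs_monic _) fun u ↦ by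
        rw [monicOfCoeffs_natDegree]; exact hn u.succ).ne_zero
    rw [iterComp_map] at hr
    simp only [monicOfCoeffs_map] at hr
    exact hr.exists_symWreath_succ

/-! ### Galois group and irreducibility -/

theorem IsGaloisLabelling.nonempty_gal_mulEquiv {L Ω ι : Type*} [Field L] [Field Ω] [Algebra L Ω]
    [IsAlgClosure L Ω] {F : L[X]} (hF : F ≠ 0) {r : ι → Ω} {W : Subgroup (Equiv.Perm ι)}
    (h : IsGaloisLabelling F r W) : Nonempty (F.Gal ≃* W) := by
  have : IsAlgClosed Ω := IsAlgClosure.isAlgClosed L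
  have : Fact (F.map (algebraMap L Ω)).Splits := ⟨IsAlgClosed.splits _⟩
  have hroot (x : Ω) : x ∈ F.rootSet Ω ↔ x ∈ Set.range r := by
    rw [mem_rootSet_of_ne hF, h.aeval_eq_zero_iff]
  let e : F.rootSet Ω ≃ ι :=
    (Equiv.setCongr (Set.ext hroot)).trans (Equiv.ofInjective r h.injective).symm
  have he (x : F.rootSet Ω) : r (e x) = x := Equiv.apply_ofInjective_symm h.injective _
  let f : F.Gal →* Equiv.Perm ι := e.permCongrHom.toMonoidHom.comp (Gal.galActionHom F Ω)
  have hf : Function.Injective f := e.permCongrHom.injective.comp (Gal.galActionHom_injective F Ω)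
  have hfr (φ : Ω ≃ₐ[L] Ω) (i : ι) : r (f (Gal.restrict F Ω φ) i) = φ (r i) := by
    have : f (Gal.restrict F Ω φ) i =
      e (Gal.galActionHom F Ω (Gal.restrict F Ω φ) (e.symm i)) := rfl
    rw [this, he, Gal.galActionHom_restrict, ← he, Equiv.apply_symm_apply]
  have hrange : f.range = W := by
    ext π
    rw [h.mem_iff]
    constructor
    · rintro ⟨g, rfl⟩
      obtain ⟨φ, rfl⟩ := Gal.restrict_surjective F Ω g
      exact ⟨φ, fun i ↦ (hfr φ i).symm⟩
    · rintro ⟨φ, hφ⟩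
      exact ⟨Gal.restrict F Ω φ, Equiv.ext fun i ↦ h.injective (by rw [hfr, hφ])⟩
  exact ⟨(MonoidHom.ofInjective hf).trans (MulEquiv.subgroupCongr hrange)⟩

/-- A monic polynomial with distinct roots and transitive Galois group is irreducible: it is the
minimal polynomial of each of its roots. -/
theorem IsGaloisLabelling.irreducible {L Ω ι : Type*} [Field L] [Field Ω] [Algebra L Ω]
    [Nonempty ι] [Finite ι] {F : L[X]} (hF : F.Monic) (hcard : F.natDegree = Nat.card ι) {r : ι → Ω}
    {W : Subgroup (Equiv.Perm ι)} (h : IsGaloisLabelling F r W)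
    (hW : ∀ i j, ∃ π ∈ W, π i = j) : Irreducible F := by
  obtain ⟨i⟩ := ‹Nonempty ι›
  have hi : aeval (r i) F = 0 := (h.aeval_eq_zero_iff _).2 ⟨i, rfl⟩
  have hint : IsIntegral L (r i) := ⟨F, hF, hi⟩
  have hroot (j) : aeval (r j) (minpoly L (r i)) = 0 := by
    obtain ⟨π, hπ, rfl⟩ := hW i j
    obtain ⟨φ, hφ⟩ := (h.mem_iff π).1 hπ
    rw [← hφ, aeval_algHom_apply, minpoly.aeval, map_zero]
  have hle : F.natDegree ≤ (minpoly L (r i)).natDegree := by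
    rw [hcard]
    have h1 : Set.range r ⊆ (minpoly L (r i)).rootSet Ω := by
      rintro _ ⟨j, rfl⟩
      exact (mem_rootSet_of_ne (minpoly.ne_zero hint)).2 (hroot j)
    rw [← Set.ncard_range_of_injective h.injective]
    exact (Set.ncard_le_ncard h1 (rootSet_finite _ _)).trans (ncard_rootSet_le _ _)
  have : minpoly L (r i) = F :=
    (eq_of_monic_of_dvd_of_natDegree_le (minpoly.monic hint) hF (minpoly.dvd L _ hi) hle).symm
  exact this ▸ minpoly.irreducible hint

theorem exists_isGaloisLabelling_genericComposite {R : Type*} [CommRing R] [IsDomain R] [CharZero R]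
    {k : ℕ} (n : Fin k → ℕ) (hn : ∀ u, n u ≠ 0) (L Ω : Type*) [Field L]
    [Algebra (CoeffRing R n) L] [IsFractionRing (CoeffRing R n) L] [Field Ω] [Algebra L Ω]
    [IsAlgClosure L Ω] :
    ∃ r : Index k n → Ω, IsGaloisLabelling
      ((genericComposite R n).map (algebraMap (CoeffRing R n) L)) r (symWreath k n) := by
  let K := FractionRing R
  let : Algebra R L := ((algebraMap (CoeffRing R n) L).comp MvPolynomial.C).toAlgebra
  have : IsScalarTower R (CoeffRing R n) L := .of_algebraMap_eq fun _ ↦ rfl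
  have hinj := IsFractionRing.injective (CoeffRing R n) L
  have : FaithfulSMul R L := (faithfulSMul_iff_algebraMap_injective R L).2
    (hinj.comp (MvPolynomial.C_injective _ _))
  let : Algebra K L := FractionRing.liftAlgebra R L
  have : IsScalarTower R K L := FractionRing.isScalarTower_liftAlgebra R L
  have : CharZero K := charZero_of_injective_algebraMap (IsFractionRing.injective R K)
  have : Algebra.IsAlgebraic R K := IsLocalization.isAlgebraic K (nonZeroDivisors R)
  let T (q) : L := algebraMap (CoeffRing R n) L (.X q)
  have hT : AlgebraicIndependent K T := by
    rw [← Algebra.IsAlgebraic.algebraicIndependent_iff R K]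
    exact (MvPolynomial.algebraicIndependent_X _ R).map'
      (f := IsScalarTower.toAlgHom R (CoeffRing R n) L) hinj
  have htop : IntermediateField.adjoin K (Set.range T) = ⊤ := by
    rw [eq_top_iff]
    have hmem (p : CoeffRing R n) :
        algebraMap _ L p ∈ IntermediateField.adjoin K (Set.range T) := by
      induction p using MvPolynomial.induction_on with
      | C a =>
        have : algebraMap (CoeffRing R n) L (.C a) = algebraMap K L (algebraMap R K a) := by
          rw [← IsScalarTower.algebraMap_apply R K L]; rfl
        rw [this]
        exact IntermediateField.algebraMap_mem _ _
      | add p q hp hq => rw [map_add]; exact add_mem hp hq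
      | mul_X p q hp =>
        rw [map_mul]
        exact mul_mem hp (IntermediateField.subset_adjoin _ _ ⟨q, rfl⟩)
    rintro x -
    obtain ⟨p, q, -, rfl⟩ := IsFractionRing.div_surjective (A := CoeffRing R n) x
    exact div_mem (hmem p) (hmem q)
  obtain ⟨r, hr⟩ := exists_isGaloisLabelling_iterComp K k n hn L T hT htop Ω
  refine ⟨r, ?_⟩
  rw [genericComposite, iterComp_map]
  convert hr using 3 with u
  exact monicOfCoeffs_map _ _

theorem genericComposite_natDegree {R : Type*} [CommRing R] [IsDomain R] {k : ℕ} (n : Fin k → ℕ) :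
    (genericComposite R n).natDegree = ∏ u, n u := by
  rw [genericComposite, iterComp_natDegree]
  exact Finset.prod_congr rfl fun u _ ↦ monicOfCoeffs_natDegree _

theorem genericComposite_monic {R : Type*} [CommRing R] [IsDomain R] {k : ℕ} (n : Fin k → ℕ)
    (hn : ∀ u, n u ≠ 0) : (genericComposite R n).Monic :=
  iterComp_monic _ _ (fun _ ↦ monicOfCoeffs_monic _) fun u ↦
    (monicOfCoeffs_natDegree _).trans_ne (hn u)

end OdoniWreath

theorem corollary5p3 (K : Type*) [Field K] [NumberField K] {k : ℕ} (hk : 1 ≤ k)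
    (n : Fin k → ℕ) (hn : ∀ u, 2 ≤ n u)
    (L : Type*) [Field L] [Algebra (OdoniWreath.CoeffRing (NumberField.RingOfIntegers K) n) L]
    [IsFractionRing (OdoniWreath.CoeffRing (NumberField.RingOfIntegers K) n) L]
    (F : Polynomial L)
    (hF : F = (OdoniWreath.genericComposite (NumberField.RingOfIntegers K) n).map
      (algebraMap (OdoniWreath.CoeffRing (NumberField.RingOfIntegers K) n) L)) :
    (Irreducible F ∧ F.natDegree = ∏ u, n u) ∧
      Nonempty (F.Gal ≃* OdoniWreath.symWreath k n) := by
  have hn0 (u) : n u ≠ 0 := by have := hn u; omega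
  obtain ⟨r, hr⟩ := OdoniWreath.exists_isGaloisLabelling_genericComposite
    (R := NumberField.RingOfIntegers K) n hn0 L (AlgebraicClosure L)
  rw [← hF] at hr
  have hA := OdoniWreath.genericComposite_monic (R := NumberField.RingOfIntegers K) n hn0
  have hmonic : F.Monic := hF ▸ hA.map _
  have hdeg : F.natDegree = ∏ u, n u := by
    rw [hF, hA.natDegree_map, OdoniWreath.genericComposite_natDegree]
  have : Nonempty (OdoniWreath.Index k n) := Finite.card_pos_iff.1 (by
    rw [OdoniWreath.card_index]
    exact Finset.prod_pos fun u _ ↦ Nat.pos_of_ne_zero (hn0 u))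
  exact ⟨⟨hr.irreducible hmonic (by rw [hdeg, OdoniWreath.card_index])
    (OdoniWreath.exists_mem_symWreath_apply_eq k n), hdeg⟩, hr.nonempty_gal_mulEquiv hmonic.ne_zero⟩
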